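/- For a sequence $\pi=\pi_1\pi_2\cdots\pi_s$ of positive integers and $r\ge 1$, let $\mathrm{exc}_r(\pi)$ be the number of $i\in\{1,\dots,s\}$ with $\pi_i\ge i+r$, and write $\mathrm{exc}=\mathrm{exc}_1$; let $\mathrm{des}(\pi)$ be the number of $i\in\{1,\dots,s\}$ such that $i=s$ or $\pi_i>\pi_{i+1}$. For integers $1\le r\le n$ define $$A_{n,r}(t)=\sum_{\pi\in\mathcal S_n}t^{\mathrm{exc}_r(\pi)},\qquad J_{n,r}(t)=\sum_{\pi\in\mathcal J_{n,r}}t^{\mathrm{exc}(\pi)},\qquad \overline{Q}_n(t)=\sum_{\pi\in\overline{\mathcal Q}_n}t^{\mathrm{des}(\pi)},$$ where $\mathcal S_n$ is the set of permutations of $[n]=\{1,\dots,n\}$; $\mathcal J_{n,r}$ is the set of injections $\pi:[n-r]\to[n]$, identified with the sequences $\pi_1\cdots\pi_{n-r}$ of their images; and $\overline{\mathcal Q}_n$ is the set of quasi-Stirling permutations, that is, of the words $\pi_1\cdots\pi_{2n}$ in which each of $1,\dots,n$ occurs exactly twice and for which there are no $i<j<k<\ell$ with $\pi_i=\pi_k$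 and $\pi_j=\pi_\ell$. Theorem. For all integers $1\le r\le n$, each of the polynomials $A_{n,r}(t)$, $J_{n,r}(t)$ and $\overline{Q}_n(t)$ is nonzero and has only real, distinct, and nonpositive roots; that is, all its complex roots are real, simple, and at most $0$. -/

import Mathlib

open Polynomial

/-- The number of `r`-excedances of a sequence `π₁ … πₛ` of elements of `[n]`: the number of
indices `i` with `πᵢ ≥ i + r`. Positions and values are both numbered from `0` here instead of
from `1`, which does not affect the inequality. -/
def excCount {s n : ℕ} (r : ℕ) (π : Fin s → Fin n) : ℕ :=
  (Finset.univ.filter fun i : Fin s => (i : ℕ) + r ≤ (π i : ℕ)).card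

/-- The number of descents of a sequence `π₁ … πₛ`: the number of indices `i` such that `i = s`
(the last position always counts) or `πᵢ > πᵢ₊₁`. Positions are numbered from `0` here. -/
def desCount {s n : ℕ} (π : Fin s → Fin n) : ℕ :=
  (Finset.univ.filter fun i : Fin s =>
    (i : ℕ) + 1 = s ∨ ∃ h : (i : ℕ) + 1 < s, π ⟨(i : ℕ) + 1, h⟩ < π i).card

/-- Quasi-Stirling permutations of size `n`: words of length `2n` in which each of the `n` letters
occurs exactly twice, and in which there are no positions `i < j < k < l` with `πᵢ = πₖ` and
`πⱼ = πₗ`. -/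
def IsQuasiStirling {n : ℕ} (π : Fin (2 * n) → Fin n) : Prop :=
  (∀ a : Fin n, (Finset.univ.filter fun i => π i = a).card = 2) ∧
    ¬ ∃ i j k l : Fin (2 * n), i < j ∧ j < k ∧ k < l ∧ π i = π k ∧ π j = π l

instance {n : ℕ} : DecidablePred (IsQuasiStirling (n := n)) := fun π => by
  unfold IsQuasiStirling
  infer_instance

/-- The `r`-Eulerian polynomial `A_{n,r}(t)`: the sum of `t ^ exc_r(π)` over all permutations `π`
of `[n]`. -/
noncomputable def rEulerianPoly (n r : ℕ) : ℝ[X] :=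
  ∑ π : Equiv.Perm (Fin n), X ^ excCount r π

/-- The polynomial `J_{n,r}(t)`: the sum of `t ^ exc(π)`, where `exc = exc_1`, over all injections
`π : [n - r] → [n]`. It is meant for `r ≤ n`. -/
noncomputable def injExcPoly (n r : ℕ) : ℝ[X] :=
  ∑ π : Fin (n - r) ↪ Fin n, X ^ excCount 1 π

/-- The quasi-Stirling polynomial: the sum of `t ^ des(π)` over all quasi-Stirling permutations `π`
of size `n`. -/
noncomputable def quasiStirlingPoly (n : ℕ) : ℝ[X] :=
  ∑ π : Fin (2 * n) → Fin n with IsQuasiStirling π, X ^ desCount π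

/-- A nonzero real polynomial has only real, distinct, nonpositive roots: it is a product of
linear factors over `ℝ` (so every complex root is real), its roots, listed with multiplicity, are
pairwise distinct, and each of them is at most `0`. -/
def HasRealDistinctNonposRoots (p : ℝ[X]) : Prop :=
  p ≠ 0 ∧ p.Splits ∧ p.roots.Nodup ∧ ∀ x ∈ p.roots, x ≤ 0

/-! All three families come from iterating `eulerOp a b`. Let p have degree d, positive leading
coefficient and d simple negative roots, and let a > 0 and b > d. Then `eulerOp a b p` is positive
at 0 and equals x(1 - x)p'(x) at each root x of p, so its signs alternate there. Its leading
coefficient is b - d times that of p, which forces one more sign change towards -∞. Hence it has d +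
1 simple negative roots (`HasSimpleNegRoots.eulerOp`).

For excedances, prepending a value to an injection [d] → [n] gives `embExcPoly_succ`, with a = r and
b = n + 1 - r. Here A is the case of permutations and J the case r = 1 with shorter domain; both
start from a positive constant.

For quasi-Stirling words, splitting at the largest letter M as u M B M v gives a quadratic
recurrence (`qsPoly_insert`). With R_n = Q_n / (1 - t)^(2n+1), the series ∑ R_n zⁿ / n! solves the
Burgers equation ∂_z u = u · t ∂_t u with initial value 1 / (1 - t). Therefore (n + 1) R_n = (t
d/dt)ⁿ (1 - t)^(-n-1) (`eq_geomNumerator_of_recurrence`). After removing one factor t, the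
numerators on the right are again iterates of `eulerOp` (`geomNumerator_succ_eq`). -/

/-! ### Polynomials with simple negative roots, and the operator `eulerOp`. -/

/-- `p` is a positive multiple of `∏ (X - x i)` for some numbers `0 > x 0 > ⋯ > x (d - 1)`. -/
def HasSimpleNegRoots (d : ℕ) (p : ℝ[X]) : Prop :=
  ∃ (c : ℝ) (x : ℕ → ℝ), 0 < c ∧ (∀ i < d, x i < 0) ∧ (∀ i j, i < j → j < d → x j < x i) ∧
    p = C c * ∏ i ∈ Finset.range d, (X - C (x i))

/-- The operator `p ↦ (a + b X) p + X (1 - X) p'`. -/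
noncomputable def eulerOp (a b : ℝ) (p : ℝ[X]) : ℝ[X] :=
  (C a + C b * X) * p + X * (1 - X) * derivative p

lemma hasRealDistinctNonposRoots_of_prod {d : ℕ} {c : ℝ} {x : ℕ → ℝ} (hc : c ≠ 0)
    (hx : ∀ i < d, x i ≤ 0) (hinj : Set.InjOn x (Finset.range d)) :
    HasRealDistinctNonposRoots (C c * ∏ i ∈ Finset.range d, (X - C (x i))) := by
  have hroots : (C c * ∏ i ∈ Finset.range d, (X - C (x i))).roots =
      (Finset.range d).val.map x := by
    rw [roots_C_mul _ hc]
    have := roots_multiset_prod_X_sub_C ((Finset.range d).val.map x)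
    rwa [Multiset.map_map] at this
  refine ⟨?_, ?_, ?_, ?_⟩
  · exact mul_ne_zero (C_ne_zero.2 hc) (Finset.prod_ne_zero_iff.2 fun i _ => X_sub_C_ne_zero _)
  · exact (Splits.C c).mul (Splits.prod fun i _ => Splits.X_sub_C _)
  · rw [hroots]
    exact Multiset.Nodup.map_on (fun a ha b hb h => hinj ha hb h) (Finset.range d).nodup
  · intro y hy
    rw [hroots, Multiset.mem_map] at hy
    obtain ⟨i, hi, rfl⟩ := hy
    exact hx i (Finset.mem_range.1 hi)

lemma injOn_of_lt {d : ℕ} {x : ℕ → ℝ} (h : ∀ i j, i < j → j < d → x j < x i) :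
    Set.InjOn x (Finset.range d) := by
  intro i hi j hj hij
  simp only [Finset.coe_range, Set.mem_Iio] at hi hj
  rcases lt_trichotomy i j with hlt | rfl | hlt
  · exact absurd hij (h i j hlt hj).ne'
  · rfl
  · exact absurd hij (h j i hlt hi).ne

lemma HasSimpleNegRoots.hasRealDistinctNonposRoots {d : ℕ} {p : ℝ[X]}
    (h : HasSimpleNegRoots d p) : HasRealDistinctNonposRoots p := by
  obtain ⟨c, x, hc, hneg, hanti, rfl⟩ := h
  exact hasRealDistinctNonposRoots_of_prod hc.ne' (fun i hi => (hneg i hi).le) (injOn_of_lt hanti)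

lemma HasSimpleNegRoots.X_mul {d : ℕ} {p : ℝ[X]}
    (h : HasSimpleNegRoots d p) : HasRealDistinctNonposRoots (X * p) := by
  obtain ⟨c, x, hc, hneg, hanti, rfl⟩ := h
  -- The new root 0 gets index 0, so the list of roots stays decreasing.
  have key : X * (C c * ∏ i ∈ Finset.range d, (X - C (x i))) = C c * ∏ i ∈ Finset.range (d + 1),
      (X - C ((fun k => Nat.casesOn k 0 x : ℕ → ℝ) i)) := by
    rw [Finset.prod_range_succ']
    simp
    ring
  rw [key]
  refine hasRealDistinctNonposRoots_of_prod hc.ne' ?_ (injOn_of_lt ?_)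
  · rintro (_ | i) hi
    · exact le_rfl
    · exact (hneg i (by omega)).le
  · rintro (_ | i) (_ | j) hij hj
    · omega
    · exact hneg j (by omega)
    · omega
    · exact hanti i j (by omega) (by omega)

lemma hasSimpleNegRoots_C {c : ℝ} (hc : 0 < c) : HasSimpleNegRoots 0 (C c) :=
  ⟨c, fun _ => 0, hc, by simp, by simp, by simp⟩

lemma HasSimpleNegRoots.const_mul {d : ℕ} {p : ℝ[X]} (h : HasSimpleNegRoots d p) {a : ℝ} (ha : 0 < a) :
    HasSimpleNegRoots d (C a * p) := by
  obtain ⟨c, x, hc, hneg, hanti, rfl⟩ := h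
  exact ⟨a * c, x, mul_pos ha hc, hneg, hanti, by rw [C_mul, mul_assoc]⟩

/-- A polynomial of degree `m` whose values alternate in sign at `0 = z 0 > z 1 > ⋯ > z m`, and
which is positive at `0`, has `m` simple negative roots. -/
lemma hasSimpleNegRoots_of_alternating {m : ℕ} {q : ℝ[X]} (hdeg : q.natDegree = m)
    (hlead : 0 < q.leadingCoeff) (z : ℕ → ℝ) (hz0 : z 0 = 0) (hz : ∀ k < m, z (k + 1) < z k)
    (hsign : ∀ k ≤ m, 0 < (-1) ^ k * q.eval (z k)) : HasSimpleNegRoots m q := by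
  have hroot : ∀ k, ∃ y, k < m → z (k + 1) < y ∧ y < z k ∧ q.eval y = 0 := by
    intro k
    by_cases hk : k < m
    · have hcont : ContinuousOn (fun t => (-1) ^ k * q.eval t) (Set.Icc (z (k + 1)) (z k)) := by
        fun_prop
      have h1 := hsign k hk.le
      have h2 := hsign (k + 1) hk
      rw [pow_succ] at h2
      obtain ⟨y, hy, hy0⟩ := intermediate_value_Ioo (hz k hk).le hcont
        (show (0 : ℝ) ∈ Set.Ioo _ _ from ⟨by linarith, h1⟩)
      refine ⟨y, fun _ => ⟨hy.1, hy.2, ?_⟩⟩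
      simpa using hy0
    · exact ⟨0, fun h => absurd h hk⟩
  choose y hy using hroot
  have hzle : ∀ i j, i ≤ j → j ≤ m → z j ≤ z i := by
    intro i j hij
    induction j, hij using Nat.le_induction with
    | base => intro _; exact le_rfl
    | succ j hij ih => intro hj; exact (hz j hj).le.trans (ih (by omega))
  have hanti : ∀ i j, i < j → j < m → y j < y i := fun i j hij hj =>
    ((hy j hj).2.1.trans_le (hzle (i + 1) j hij hj.le)).trans (hy i (hij.trans hj)).1
  refine ⟨q.leadingCoeff, y, hlead, fun i hi => ?_, hanti, ?_⟩
  · have := hzle 0 i (Nat.zero_le _) hi.le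
    rw [hz0] at this
    exact (hy i hi).2.1.trans_le this
  · have hinj := injOn_of_lt hanti
    -- The m distinct zeros already exhaust the degree, so they are all the roots, each simple.
    have hsub : (Finset.range m).val.map y ≤ q.roots := by
      rw [Multiset.le_iff_subset (Multiset.Nodup.map_on (fun a ha b hb h => hinj ha hb h)
        (Finset.range m).nodup)]
      intro t ht
      obtain ⟨i, hi, rfl⟩ := Multiset.mem_map.1 ht
      rw [mem_roots (leadingCoeff_ne_zero.1 hlead.ne')]
      exact (hy i (Finset.mem_range.1 hi)).2.2
    have heq : (Finset.range m).val.map y = q.roots := by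
      refine Multiset.eq_of_le_of_card_le hsub ?_
      rw [Multiset.card_map, Finset.card_val, Finset.card_range, ← hdeg]
      exact card_roots' q
    have hcard : q.roots.card = q.natDegree := by
      rw [← heq, Multiset.card_map, Finset.card_val, Finset.card_range, hdeg]
    have := C_leadingCoeff_mul_prod_multiset_X_sub_C hcard
    rw [← heq, Multiset.map_map] at this
    exact this.symm

/-- The derivative at x i is c times the product of x i - x j over j ≠ i, and exactly the i factors
with j < i are negative. -/
lemma HasSimpleNegRoots.eval_derivative_sign {d : ℕ} {c : ℝ} {x : ℕ → ℝ} (hc : 0 < c)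
    (hanti : ∀ i j, i < j → j < d → x j < x i) {i : ℕ} (hi : i < d) :
    0 < (-1) ^ i * (derivative (C c * ∏ i ∈ Finset.range d, (X - C (x i)))).eval (x i) := by
  have h1 : (derivative (C c * ∏ i ∈ Finset.range d, (X - C (x i)))).eval (x i) =
      c * ∏ j ∈ (Finset.range d).erase i, (x i - x j) := by
    rw [derivative_C_mul, eval_mul, eval_C]
    congr 1
    have := Lagrange.eval_nodal_derivative_eval_node_eq (s := Finset.range d) (v := x)
      (Finset.mem_range.2 hi)
    rw [Lagrange.nodal, Lagrange.nodal, eval_prod] at this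
    simpa using this
  have h2 : (Finset.range d).erase i = Finset.range i ∪ Finset.Ico (i + 1) d := by
    ext j
    simp
    omega
  have h3 : Disjoint (Finset.range i) (Finset.Ico (i + 1) d) := by
    rw [Finset.disjoint_left]
    intro j
    simp
    omega
  have h4 : (-1 : ℝ) ^ i * ∏ j ∈ Finset.range i, (x i - x j) =
      ∏ j ∈ Finset.range i, (x j - x i) := by
    conv_lhs => rw [← Finset.card_range i, ← Finset.prod_const, Finset.card_range,
      ← Finset.prod_mul_distrib]
    exact Finset.prod_congr rfl fun j _ => by ring
  rw [h1, h2, Finset.prod_union h3]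
  have : (-1 : ℝ) ^ i * (c * ((∏ j ∈ Finset.range i, (x i - x j)) *
      ∏ j ∈ Finset.Ico (i + 1) d, (x i - x j))) =
      c * ((∏ j ∈ Finset.range i, (x j - x i)) * ∏ j ∈ Finset.Ico (i + 1) d, (x i - x j)) := by
    rw [← h4]; ring
  rw [this]
  refine mul_pos hc (mul_pos (Finset.prod_pos fun j hj => ?_) (Finset.prod_pos fun j hj => ?_))
  · exact sub_pos.2 (hanti j i (Finset.mem_range.1 hj) hi)
  · rw [Finset.mem_Ico] at hj
    exact sub_pos.2 (hanti i j hj.1 hj.2)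

lemma natDegree_eulerOp_le {a b : ℝ} {p : ℝ[X]} {d : ℕ} (hp : p.natDegree ≤ d) :
    (eulerOp a b p).natDegree ≤ d + 1 := by
  rw [natDegree_le_iff_coeff_eq_zero]
  intro N hN
  obtain ⟨k, rfl⟩ : ∃ k, N = k + 2 := ⟨N - 2, by omega⟩
  have h0 : ∀ j, d < j → p.coeff j = 0 := fun j hj => coeff_eq_zero_of_natDegree_lt (by omega)
  rw [eulerOp, show (C a + C b * X) * p + X * (1 - X) * derivative p =
    C a * p + C b * (p * X) + derivative p * X - derivative p * X * X by ring]
  simp [coeff_derivative, h0 (k + 1) (by omega), h0 (k + 2) (by omega)]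

/-- The term b X p contributes b, and -X² p' contributes -d. -/
lemma coeff_eulerOp_succ {a b : ℝ} {p : ℝ[X]} {d : ℕ} (hp : p.natDegree ≤ d) :
    (eulerOp a b p).coeff (d + 1) = (b - d) * p.coeff d := by
  have h0 : p.coeff (d + 1) = 0 := coeff_eq_zero_of_natDegree_lt (by omega)
  rw [eulerOp, show (C a + C b * X) * p + X * (1 - X) * derivative p =
    C a * p + C b * (p * X) + derivative p * X - derivative p * X * X by ring]
  rcases d with _ | d
  · simp [coeff_derivative, h0]
  · simp [coeff_derivative, h0]
    ring

lemma HasSimpleNegRoots.eulerOp {d : ℕ} {p : ℝ[X]} (h : HasSimpleNegRoots d p) {a b : ℝ}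
    (ha : 0 < a) (hb : d < b) : HasSimpleNegRoots (d + 1) (eulerOp a b p) := by
  obtain ⟨c, x, hc, hneg, hanti, hp⟩ := h
  have hmonic : (∏ i ∈ Finset.range d, (X - C (x i))).Monic :=
    monic_prod_of_monic _ _ fun i _ => monic_X_sub_C _
  have hdegp : p.natDegree = d := by
    rw [hp, natDegree_C_mul hc.ne', natDegree_prod_of_monic _ _ fun i _ => monic_X_sub_C _]
    simp
  have hlc : p.coeff d = c := by
    rw [← hdegp, coeff_natDegree, hp, leadingCoeff_mul, hmonic.leadingCoeff, leadingCoeff_C,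
      mul_one]
  have hcoeff : (_root_.eulerOp a b p).coeff (d + 1) = (b - d) * c := by
    rw [coeff_eulerOp_succ hdegp.le, hlc]
  have hpos : 0 < (b - d) * c := mul_pos (sub_pos.2 hb) hc
  have hdeg : (_root_.eulerOp a b p).natDegree = d + 1 :=
    natDegree_eq_of_le_of_coeff_ne_zero (natDegree_eulerOp_le hdegp.le) (by
      rw [hcoeff]; exact hpos.ne')
  have hlead : 0 < (_root_.eulerOp a b p).leadingCoeff := by
    rw [← coeff_natDegree, hdeg, hcoeff]; exact hpos
  have hroot : ∀ i < d, p.eval (x i) = 0 := by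
    intro i hi
    rw [hp, eval_mul, eval_prod, Finset.prod_eq_zero (Finset.mem_range.2 hi) (by simp), mul_zero]
  have hev : ∀ i < d, (_root_.eulerOp a b p).eval (x i) =
      x i * (1 - x i) * (derivative p).eval (x i) := by
    intro i hi
    simp [_root_.eulerOp, hroot i hi]
  -- Substituting -X turns the behaviour at -∞ into the behaviour at +∞, where the leading
  -- coefficient decides the sign.
  have hfar : ∃ L : ℝ, L < 0 ∧ (∀ i < d, L < x i) ∧
      0 < (-1) ^ (d + 1) * (_root_.eulerOp a b p).eval L := by
    set q := _root_.eulerOp a b p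
    have hcomp : 0 < ((-1) ^ (d + 1) * q.comp (-X)).leadingCoeff := by
      rw [show ((-1 : ℝ[X]) ^ (d + 1)) = C ((-1) ^ (d + 1)) by simp, leadingCoeff_mul,
        leadingCoeff_C, leadingCoeff_comp (by simp), hdeg]
      simp only [leadingCoeff_neg, leadingCoeff_X]
      rw [mul_left_comm, ← mul_pow]
      simpa using hlead
    have hdeg' : 0 < ((-1) ^ (d + 1) * q.comp (-X)).degree := by
      rw [← natDegree_pos_iff_degree_pos, show ((-1 : ℝ[X]) ^ (d + 1)) = C ((-1) ^ (d + 1)) by simp,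
        natDegree_C_mul (by simp), natDegree_comp, hdeg]
      simp
    have htend := tendsto_atTop_of_leadingCoeff_nonneg _ hdeg' hcomp.le
    have hall : ∀ᶠ t : ℝ in Filter.atTop, ∀ i ∈ Finset.range d, -x i < t :=
      (Filter.eventually_all_finset _).2 fun i _ => Filter.eventually_gt_atTop _
    obtain ⟨t, ht1, ht2, ht3⟩ := ((htend.eventually_gt_atTop 0).and
      ((Filter.eventually_gt_atTop 0).and hall)).exists
    refine ⟨-t, by linarith, fun i hi => ?_, ?_⟩
    · linarith [ht3 i (Finset.mem_range.2 hi)]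
    · simpa using ht1
  obtain ⟨L, hL0, hLx, hLs⟩ := hfar
  -- The d + 2 test points are 0, the roots of p in decreasing order, and L.
  refine hasSimpleNegRoots_of_alternating hdeg hlead
    (fun k => Nat.casesOn k 0 fun k => if k < d then x k else L) rfl ?_ ?_
  · rintro (_ | k) hk
    · by_cases h : 0 < d
      · simpa [h] using hneg 0 h
      · simpa [h] using hL0
    · have hk' : k < d := by omega
      by_cases h : k + 1 < d
      · simpa [h, hk'] using hanti k (k + 1) (by omega) h
      · simpa [h, hk'] using hLx k hk'
  · rintro (_ | k) hk
    · have : 0 < p.eval 0 := by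
        rw [hp, eval_mul, eval_prod, eval_C]
        refine mul_pos hc (Finset.prod_pos fun i hi => ?_)
        simpa using hneg i (Finset.mem_range.1 hi)
      simp [_root_.eulerOp, ha, this]
    · by_cases h : k < d
      · simp only [h, if_true]
        rw [hev k h, pow_succ]
        have := HasSimpleNegRoots.eval_derivative_sign hc hanti h
        rw [← hp] at this
        have h2 : 0 < -x k * (1 - x k) := mul_pos (by linarith [hneg k h]) (by linarith [hneg k h])
        nlinarith [mul_pos h2 this]
      · have hkd : k = d := by omega
        subst hkd
        simpa using hLs

lemma X_mul_derivative_X_pow (e : ℕ) : (X : ℝ[X]) * derivative (X ^ e) = C (e : ℝ) * X ^ e := by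
  rcases e with _ | e
  · simp
  · rw [derivative_X_pow, Nat.add_sub_cancel, pow_succ]
    ring

/-! ### Excedances over injections. -/

/-- The generating polynomial of `r`-excedances over injections `[d] → [n]`. -/
noncomputable def embExcPoly (d n r : ℕ) : ℝ[X] :=
  ∑ π : Fin d ↪ Fin n, X ^ excCount r π

/-- Prepend the value `p` to an injection, swapping `p` with `0` in its shifted image. -/
def insertFirst {d n : ℕ} (p : Fin (n + 1)) (π : Fin d ↪ Fin n) : Fin (d + 1) ↪ Fin (n + 1) where
  toFun := Fin.cons p fun i => Equiv.swap 0 p (π i).succ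
  inj' := by
    rw [Fin.cons_injective_iff]
    refine ⟨?_, fun i j h => π.injective (Fin.succ_injective _ ((Equiv.swap 0 p).injective h))⟩
    rintro ⟨i, hi⟩
    have := congrArg (Equiv.swap 0 p) hi
    rw [Equiv.swap_apply_self, Equiv.swap_apply_right] at this
    exact Fin.succ_ne_zero _ this

lemma insertFirst_zero {d n : ℕ} (p : Fin (n + 1)) (π : Fin d ↪ Fin n) :
    insertFirst p π 0 = p := rfl

lemma insertFirst_succ {d n : ℕ} (p : Fin (n + 1)) (π : Fin d ↪ Fin n) (i : Fin d) :
    insertFirst p π i.succ = Equiv.swap 0 p (π i).succ := rfl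

lemma insertFirst_bijective (d n : ℕ) : Function.Bijective
    fun x : Fin (n + 1) × (Fin d ↪ Fin n) => insertFirst x.1 x.2 := by
  constructor
  · rintro ⟨p, π⟩ ⟨q, σ⟩ h
    have h0 : p = q := DFunLike.congr_fun h 0
    subst h0
    refine Prod.ext rfl (DFunLike.ext _ _ fun i => ?_)
    exact Fin.succ_injective _ ((Equiv.swap 0 p).injective (DFunLike.congr_fun h i.succ))
  · intro τ
    have hne : ∀ i : Fin d, Equiv.swap 0 (τ 0) (τ i.succ) ≠ 0 := by
      intro i h
      have : τ i.succ = τ 0 := by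
        rw [← Equiv.swap_apply_self 0 (τ 0) (τ i.succ), h, Equiv.swap_apply_left]
      exact Fin.succ_ne_zero _ (τ.injective this)
    refine ⟨(τ 0, ⟨fun i => (Equiv.swap 0 (τ 0) (τ i.succ)).pred (hne i), fun i j h => ?_⟩), ?_⟩
    · exact Fin.succ_injective _ (τ.injective ((Equiv.swap 0 (τ 0)).injective (Fin.pred_inj.1 h)))
    · refine DFunLike.ext _ _ fun i => ?_
      refine Fin.cases rfl (fun i => ?_) i
      simp only [insertFirst_succ]
      exact (congrArg _ (Fin.succ_pred _ (hne i))).trans (Equiv.swap_apply_self _ _ _)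

lemma card_excedances_insertFirst_tail {d n r : ℕ} (p : Fin (n + 1)) (π : Fin d ↪ Fin n) :
    (Finset.univ.filter fun i : Fin d => (i.succ : ℕ) + r ≤ insertFirst p π i.succ) =
      Finset.univ.filter fun i : Fin d => (i : ℕ) + r ≤ π i ∧ p ≠ (π i).succ := by
  ext i
  rw [Finset.mem_filter, Finset.mem_filter, insertFirst_succ]
  simp only [Finset.mem_univ, true_and]
  by_cases h : p = (π i).succ
  · subst h
    simp
  · rw [Equiv.swap_apply_of_ne_of_ne (Fin.succ_ne_zero _) (Ne.symm h)]
    simp only [Fin.val_succ, ne_eq, h, not_false_eq_true, and_true]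
    omega

/-- Shifting position and value together preserves excedances, except that the entry whose shifted
value is p is sent to 0 and stops being one. The new first entry is an excedance iff r ≤ p. So a
gain and a loss cancel when p is the shifted value of an excedance, which already forces p > r. -/
lemma excCount_insertFirst {d n r : ℕ} (p : Fin (n + 1)) (π : Fin d ↪ Fin n) :
    excCount r (insertFirst p π) = if (p : ℕ) < r ∨ (∃ i : Fin d, (i : ℕ) + r ≤ π i ∧ (π i).succ = p) then
      excCount r π else excCount r π + 1 := by
  have h0 : excCount r (insertFirst p π) = (if r ≤ (p : ℕ) then 1 else 0) +
      (Finset.univ.filter fun i : Fin d => (i : ℕ) + r ≤ π i ∧ p ≠ (π i).succ).card := by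
    rw [← card_excedances_insertFirst_tail, excCount, Fin.card_filter_univ_succ']
    simp [insertFirst_zero]
  rw [h0]
  by_cases hi : ∃ i : Fin d, (i : ℕ) + r ≤ π i ∧ (π i).succ = p
  · rw [if_pos (Or.inr hi)]
    obtain ⟨i, hi, rfl⟩ := hi
    have h1 : (Finset.univ.filter fun j : Fin d => (j : ℕ) + r ≤ π j ∧ (π i).succ ≠ (π j).succ) =
        (Finset.univ.filter fun j : Fin d => (j : ℕ) + r ≤ π j).erase i := by
      ext j
      simp [Fin.succ_inj, π.injective.eq_iff, and_comm, eq_comm]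
    rw [h1, if_pos (by simp; omega), add_comm, excCount]
    exact Finset.card_erase_add_one (by simpa using hi)
  · have h1 : (Finset.univ.filter fun j : Fin d => (j : ℕ) + r ≤ π j ∧ p ≠ (π j).succ) =
        (Finset.univ.filter fun j : Fin d => (j : ℕ) + r ≤ π j) := by
      refine Finset.filter_congr fun j _ => ⟨fun h => h.1, fun h => ⟨h, fun hp => hi ⟨j, h, hp.symm⟩⟩⟩
    rw [h1, ← excCount]
    by_cases hp : (p : ℕ) < r
    · simp [hp, not_le.2 hp]
    · rw [if_pos (not_lt.1 hp), if_neg (not_or.2 ⟨hp, hi⟩), add_comm]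

lemma card_insertFirst_unchanged {d n r : ℕ} (hrn : r ≤ n + 1) (π : Fin d ↪ Fin n) :
    (Finset.univ.filter fun p : Fin (n + 1) =>
      (p : ℕ) < r ∨ (∃ i : Fin d, (i : ℕ) + r ≤ π i ∧ (π i).succ = p)).card = r + excCount r π := by
  rw [Finset.filter_or, Finset.card_union_of_disjoint]
  · congr 1
    · rw [Fin.card_filter_val_lt, min_eq_right hrn]
    · rw [excCount, ← Finset.card_map (π.trans (Fin.succEmb n))]
      congr 1
      ext p
      simp
  · rw [Finset.disjoint_left]
    intro p hp
    simp only [Finset.mem_filter, Finset.mem_univ, true_and] at hp ⊢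
    rintro ⟨i, hi, rfl⟩
    simp at hp
    omega

lemma sum_insertFirst {d n r : ℕ} (hrn : r ≤ n + 1) (π : Fin d ↪ Fin n) :
    ∑ p : Fin (n + 1), (X : ℝ[X]) ^ excCount r (insertFirst p π) =
      eulerOp r (n + 1 - r) (X ^ excCount r π) := by
  have hcard := card_insertFirst_unchanged hrn π
  have hcompl := Finset.card_filter_add_card_filter_not (s := Finset.univ)
    (fun p : Fin (n + 1) => (p : ℕ) < r ∨ (∃ i : Fin d, (i : ℕ) + r ≤ π i ∧ (π i).succ = p))
  rw [hcard, Finset.card_univ, Fintype.card_fin] at hcompl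
  -- The number of p that gain an excedance is obtained as a complement in ℝ[X], avoiding truncated
  -- subtraction.
  have hcompl' := congrArg (fun k : ℕ => (k : ℝ[X])) hcompl
  push_cast at hcompl'
  simp_rw [excCount_insertFirst, apply_ite (fun k => (X : ℝ[X]) ^ k)]
  rw [Finset.sum_ite, Finset.sum_const, Finset.sum_const, hcard, eulerOp, mul_assoc, mul_left_comm,
    X_mul_derivative_X_pow]
  simp only [nsmul_eq_mul, Nat.cast_add, map_natCast, map_sub, map_add, map_one]
  rw [pow_succ]
  linear_combination (X : ℝ[X]) ^ excCount r π * X * hcompl'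

lemma eulerOp_sum {ι : Type*} (s : Finset ι) (a b : ℝ) (f : ι → ℝ[X]) :
    eulerOp a b (∑ i ∈ s, f i) = ∑ i ∈ s, eulerOp a b (f i) := by
  simp only [eulerOp, derivative_sum, Finset.mul_sum, Finset.sum_add_distrib]

lemma embExcPoly_succ {d n r : ℕ} (hrn : r ≤ n + 1) :
    embExcPoly (d + 1) (n + 1) r = eulerOp r (n + 1 - r) (embExcPoly d n r) := by
  rw [embExcPoly, embExcPoly, eulerOp_sum, ← (insertFirst_bijective d n).sum_comp
    (fun π => (X : ℝ[X]) ^ excCount r π), Fintype.sum_prod_type, Finset.sum_comm]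
  exact Finset.sum_congr rfl fun π _ => sum_insertFirst hrn π

lemma rEulerianPoly_eq (n r : ℕ) : rEulerianPoly n r = embExcPoly n n r := by
  refine Fintype.sum_bijective (fun π : Equiv.Perm (Fin n) => π.toEmbedding)
    ⟨Equiv.toEmbedding_injective, fun τ => ⟨τ.equivOfFiniteSelfEmbedding, ?_⟩⟩ _ _ fun _ => rfl
  exact Function.Embedding.toEmbedding_equivOfFiniteSelfEmbedding τ

lemma hasSimpleNegRoots_rEulerianPoly {n r : ℕ} (hr : 1 ≤ r) (hrn : r ≤ n) :
    HasSimpleNegRoots (n - r) (rEulerianPoly n r) := by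
  rw [rEulerianPoly_eq]
  induction n, hrn using Nat.le_induction with
  | base =>
    have h : ∀ π : Fin r ↪ Fin r, excCount r π = 0 := by
      intro π
      refine Finset.card_eq_zero.2 (Finset.filter_eq_empty_iff.2 fun i _ => ?_)
      have := (π i).isLt
      omega
    simp only [embExcPoly, h, pow_zero, Finset.sum_const, Finset.card_univ, Nat.sub_self,
      nsmul_eq_mul, mul_one]
    rw [← map_natCast (C : ℝ →+* ℝ[X])]
    refine hasSimpleNegRoots_C (Nat.cast_pos.2 (Fintype.card_pos_iff.2 ⟨Function.Embedding.refl _⟩))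
  | succ n hrn ih =>
    rw [embExcPoly_succ (by omega), show n + 1 - r = n - r + 1 by omega]
    -- Here b = n + 1 - r exceeds the current degree n - r by exactly one.
    refine ih.eulerOp (by exact_mod_cast hr) ?_
    rw [Nat.cast_sub hrn]
    linarith

lemma hasSimpleNegRoots_injExcPoly {n r : ℕ} (hr : 1 ≤ r) (hrn : r ≤ n) :
    HasSimpleNegRoots (n - r) (injExcPoly n r) := by
  change HasSimpleNegRoots (n - r) (embExcPoly (n - r) n 1)
  induction n, hrn using Nat.le_induction with
  | base =>
    have h : ∀ π : Fin (r - r) ↪ Fin r, excCount 1 π = 0 := by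
      intro π
      refine Finset.card_eq_zero.2 (Finset.filter_eq_empty_iff.2 fun i _ => ?_)
      have := i.isLt
      omega
    simp only [embExcPoly, h, pow_zero, Finset.sum_const, Finset.card_univ, nsmul_eq_mul, mul_one]
    rw [← map_natCast (C : ℝ →+* ℝ[X]), Nat.sub_self]
    exact hasSimpleNegRoots_C (Nat.cast_pos.2 (Fintype.card_pos_iff.2
      ⟨⟨fun i => i.elim0, fun i => i.elim0⟩⟩))
  | succ n hrn ih =>
    rw [show n + 1 - r = n - r + 1 by omega, embExcPoly_succ (by omega)]
    -- Here b = n, and n > n - r because r ≥ 1.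
    refine ih.eulerOp (by simp) ?_
    rw [Nat.cast_sub hrn]
    have : (1 : ℝ) ≤ r := by exact_mod_cast hr
    push_cast
    linarith

/-! ### Derivations of power series and the Burgers equation. -/

/-- The derivation of `A⟦X⟧` that applies a derivation of `A` to every coefficient. -/
noncomputable def coeffDerivation {A : Type*} [CommRing A] [Algebra ℝ A] (D : Derivation ℝ A A) :
    Derivation ℝ (PowerSeries A) (PowerSeries A) :=
  Derivation.mk'
    { toFun := fun f => PowerSeries.mk fun n => D (PowerSeries.coeff n f)
      map_add' := fun f g => by ext n; simp
      map_smul' := fun c f => by ext n; simp }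
    (fun f g => by
      ext n
      simp only [LinearMap.coe_mk, AddHom.coe_mk, PowerSeries.coeff_mk, PowerSeries.coeff_mul,
        map_sum, map_add, smul_eq_mul, Derivation.leibniz, Finset.sum_add_distrib]
      congr 1
      rw [← Finset.Nat.sum_antidiagonal_swap]
      rfl)

lemma coeff_coeffDerivation {A : Type*} [CommRing A] [Algebra ℝ A] (D : Derivation ℝ A A) (n : ℕ)
    (f : PowerSeries A) :
    PowerSeries.coeff n (coeffDerivation D f) = D (PowerSeries.coeff n f) := by
  simp [coeffDerivation]

/-- If `D₁ u = u · D₂ u` for commuting derivations, then `(n + 1) D₁ⁿ u = D₂ⁿ (uⁿ⁺¹)`. -/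
lemma iterate_derivation_of_burgers {R₁ R₂ B : Type*} [CommRing R₁] [CommRing R₂] [CommRing B]
    [IsDomain B] [CharZero B] {_ : Algebra R₁ B} {_ : Algebra R₂ B}
    (D₁ : Derivation R₁ B B) (D₂ : Derivation R₂ B B) (hcomm : Function.Commute D₁ D₂) {u : B}
    (hu : D₁ u = u * D₂ u) (n : ℕ) : (n + 1 : B) * D₁^[n] u = D₂^[n] (u ^ (n + 1)) := by
  induction n with
  | zero => simp
  | succ n ih =>
    have hnat₁ : ∀ (k : ℕ) (v : B), D₁ ((k : B) * v) = k * D₁ v := by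
      intro k v
      rw [← nsmul_eq_mul, map_nsmul, nsmul_eq_mul]
    have hnat₂ : ∀ (k : ℕ) (v : B), D₂ ((k : B) * v) = k * D₂ v := by
      intro k v
      rw [← nsmul_eq_mul, map_nsmul, nsmul_eq_mul]
    -- By the equation for u, both sides equal (n + 1)(n + 2) uⁿ⁺¹ D₂ u.
    have h1 : D₁ (u ^ (n + 1)) * (n + 2 : ℕ) = (n + 1 : ℕ) * D₂ (u ^ (n + 2)) := by
      rw [Derivation.leibniz_pow, Derivation.leibniz_pow, hu]
      simp only [nsmul_eq_mul, smul_eq_mul, Nat.add_sub_cancel]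
      rw [show n + 2 - 1 = n + 1 from rfl]
      ring
    have h2 : (n + 1 : ℕ) * D₁^[n + 1] u = D₂^[n] (D₁ (u ^ (n + 1))) := by
      rw [Function.iterate_succ_apply', ← hnat₁, Nat.cast_succ, ih]
      exact (hcomm.iterate_right n).eq _
    have hiter : ∀ (k m : ℕ) (v : B), D₂^[m] ((k : B) * v) = k * D₂^[m] v := by
      intro k m v
      induction m with
      | zero => rfl
      | succ m ihm => rw [Function.iterate_succ_apply', Function.iterate_succ_apply', ihm, hnat₂]
    have h3 : ((n + 1 : ℕ) : B) * ((n + 2 : ℕ) * D₁^[n + 1] u) =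
        (n + 1 : ℕ) * D₂^[n + 1] (u ^ (n + 2)) := by
      rw [mul_left_comm, h2, ← hiter, mul_comm, h1, hiter, Function.iterate_succ_apply]
    have := mul_left_cancel₀ (Nat.cast_ne_zero.2 n.succ_ne_zero) h3
    push_cast at this ⊢
    rw [← this]
    ring

/-! ### Iterates of t d/dt on powers of 1 / (1 - t). -/

/-- The derivation `t d/dt` of `ℝ⟦t⟧`. -/
noncomputable def eulerDerivation : Derivation ℝ (PowerSeries ℝ) (PowerSeries ℝ) :=
  (PowerSeries.X : PowerSeries ℝ) • PowerSeries.derivative ℝ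

/-- The power series `1 / (1 - t)`. -/
noncomputable def geomSeries : PowerSeries ℝ := PowerSeries.mk 1

lemma geomSeries_mul : geomSeries * (1 - PowerSeries.X) = 1 :=
  PowerSeries.mk_one_mul_one_sub_eq_one ℝ

lemma eulerDerivation_geomSeries :
    eulerDerivation geomSeries = PowerSeries.X * geomSeries ^ 2 := by
  have h := congrArg eulerDerivation geomSeries_mul
  rw [Derivation.leibniz] at h
  have hX : eulerDerivation (1 - PowerSeries.X) = -PowerSeries.X := by
    simp [eulerDerivation]
  rw [hX] at h
  rw [smul_eq_mul, smul_eq_mul, Derivation.map_one_eq_zero] at h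
  linear_combination geomSeries * h - eulerDerivation geomSeries * geomSeries_mul

/-- `t d/dt (p / (1 - t)ᵏ) = t ((1 - t) p' + k p) / (1 - t)ᵏ⁺¹`. -/
lemma eulerDerivation_mul_geomSeries_pow (p : ℝ[X]) (k : ℕ) :
    eulerDerivation ((p : PowerSeries ℝ) * geomSeries ^ k) =
      ((X * ((1 - X) * derivative p + C (k : ℝ) * p) : ℝ[X]) : PowerSeries ℝ) *
        geomSeries ^ (k + 1) := by
  have hp : eulerDerivation (p : PowerSeries ℝ) =
      PowerSeries.X * ((derivative p : ℝ[X]) : PowerSeries ℝ) := by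
    simp [eulerDerivation, PowerSeries.derivative_coe]
  rw [Derivation.leibniz, Derivation.leibniz_pow, hp, eulerDerivation_geomSeries]
  simp only [nsmul_eq_mul, smul_eq_mul, Polynomial.coe_mul, Polynomial.coe_X, Polynomial.coe_add,
    Polynomial.coe_sub, Polynomial.coe_one, Polynomial.coe_C]
  rw [map_natCast]
  rcases k with _ | k
  · rw [Nat.cast_zero]
    linear_combination -PowerSeries.X * ((derivative p : ℝ[X]) : PowerSeries ℝ) * geomSeries_mul
  · rw [Nat.add_sub_cancel]
    linear_combination -PowerSeries.X * ((derivative p : ℝ[X]) : PowerSeries ℝ) *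
      geomSeries ^ (k + 1) * geomSeries_mul

lemma coe_mul_geomSeries_pow_inj {p q : ℝ[X]} {k : ℕ}
    (h : (p : PowerSeries ℝ) * geomSeries ^ k = q * geomSeries ^ k) : p = q := by
  have hu : IsUnit (geomSeries ^ k) := (IsUnit.of_mul_eq_one _ geomSeries_mul).pow k
  exact Polynomial.coe_injective ℝ (hu.mul_right_cancel h)

/-- The numerators of `(t d/dt)ʲ (1 - t)⁻ᵏ`. -/
noncomputable def geomNumerator (k : ℕ) : ℕ → ℝ[X]
  | 0 => 1
  | j + 1 => X * ((1 - X) * derivative (geomNumerator k j) +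
      C ((k + j : ℕ) : ℝ) * geomNumerator k j)

lemma iterate_eulerDerivation_geomSeries_pow (k j : ℕ) :
    eulerDerivation^[j] (geomSeries ^ k) = (geomNumerator k j : PowerSeries ℝ) *
      geomSeries ^ (k + j) := by
  induction j with
  | zero => simp [geomNumerator]
  | succ j ih =>
    rw [Function.iterate_succ_apply', ih, eulerDerivation_mul_geomSeries_pow]
    rfl

/-- Substituting X s into the recurrence and cancelling X turns it into `eulerOp 1 (k + j)` acting
on s, of degree j < k + j. -/
lemma geomNumerator_succ_eq (k j : ℕ) (hk : 1 ≤ k) : ∃ s : ℝ[X], HasSimpleNegRoots j s ∧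
    geomNumerator k (j + 1) = X * s := by
  induction j with
  | zero =>
    refine ⟨C (k : ℝ), hasSimpleNegRoots_C (by exact_mod_cast hk), ?_⟩
    simp [geomNumerator]
  | succ j ih =>
    obtain ⟨s, hs, h⟩ := ih
    refine ⟨eulerOp 1 (k + j) s, hs.eulerOp one_pos ?_, ?_⟩
    · have : (1 : ℝ) ≤ k := by exact_mod_cast hk
      linarith
    · rw [geomNumerator, h, eulerOp]
      simp
      ring

/-- A sequence of polynomials obeying the recurrence of the quasi-Stirling polynomials is given by
the numerators of `(t d/dt)ⁿ (1 - t)⁻ⁿ⁻¹`, up to scaling. -/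
lemma eq_geomNumerator_of_recurrence (q : ℕ → ℝ[X]) (h0 : q 0 = 1)
    (hrec : ∀ n, q (n + 1) = ∑ x ∈ Finset.HasAntidiagonal.antidiagonal n, C (n.choose x.1 : ℝ) * (q x.1 *
      (X * ((1 - X) * derivative (q x.2) + C ((2 * x.2 + 1 : ℕ) : ℝ) * q x.2)))) (n : ℕ) :
    C (n + 1 : ℝ) * q n = geomNumerator (n + 1) n := by
  let R : ℕ → PowerSeries ℝ := fun n => (q n : PowerSeries ℝ) * geomSeries ^ (2 * n + 1)
  have hR : ∀ n, R (n + 1) = ∑ x ∈ Finset.HasAntidiagonal.antidiagonal n, PowerSeries.C (n.choose x.1 : ℝ) *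
      (R x.1 * eulerDerivation (R x.2)) := by
    intro n
    simp only [R, hrec, eulerDerivation_mul_geomSeries_pow]
    rw [← Polynomial.coeToPowerSeries.ringHom_apply, map_sum, Finset.sum_mul]
    refine Finset.sum_congr rfl fun x hx => ?_
    rw [Finset.HasAntidiagonal.mem_antidiagonal] at hx
    rw [show 2 * (n + 1) + 1 = (2 * x.1 + 1) + (2 * x.2 + 1 + 1) by omega, pow_add]
    simp only [Polynomial.coeToPowerSeries.ringHom_apply, Polynomial.coe_mul, Polynomial.coe_C]
    ring
  -- The exponential generating function of R: the outer variable is z, the coefficients are series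
  -- in t. The binomial convolution `hR` becomes the Burgers equation `hu`.
  let u : PowerSeries (PowerSeries ℝ) :=
    PowerSeries.mk fun n => PowerSeries.C ((n.factorial : ℝ)⁻¹) * R n
  let D₁ := PowerSeries.derivative (PowerSeries ℝ)
  have hcoeff : ∀ n, PowerSeries.constantCoeff (D₁^[n] u) = R n := by
    intro n
    have := PowerSeries.constantCoeff_iterate_derivative u n
    change PowerSeries.constantCoeff (D₁^[n] u) = _ at this
    rw [this, PowerSeries.coeff_mk, ← mul_assoc, ← map_natCast (PowerSeries.C (R := ℝ)),
      ← map_mul, mul_inv_cancel₀ (by positivity), map_one, one_mul]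
  have hconst : ∀ n v, PowerSeries.constantCoeff ((coeffDerivation eulerDerivation)^[n] v) =
      eulerDerivation^[n] (PowerSeries.constantCoeff v) := by
    intro n v
    induction n with
    | zero => rfl
    | succ n ih =>
      rw [Function.iterate_succ_apply', Function.iterate_succ_apply', ← ih,
        ← PowerSeries.coeff_zero_eq_constantCoeff_apply, coeff_coeffDerivation,
        PowerSeries.coeff_zero_eq_constantCoeff_apply]
  have hC : ∀ (c : ℝ) (v : PowerSeries ℝ), eulerDerivation (PowerSeries.C c * v) =
      PowerSeries.C c * eulerDerivation v := by
    intro c v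
    have hc : eulerDerivation (PowerSeries.C c) = 0 := by simp [eulerDerivation]
    rw [Derivation.leibniz, hc, smul_zero, add_zero, smul_eq_mul]
  have hD₁ : ∀ n v, PowerSeries.coeff n (D₁ v) = PowerSeries.coeff (n + 1) v * (n + 1) :=
    fun n v => PowerSeries.coeff_derivative v n
  have hu : D₁ u = u * coeffDerivation eulerDerivation u := by
    ext1 n
    rw [hD₁, PowerSeries.coeff_mul, PowerSeries.coeff_mk, hR, Finset.mul_sum, Finset.sum_mul]
    refine Finset.sum_congr rfl fun x hx => ?_
    rw [Finset.HasAntidiagonal.mem_antidiagonal] at hx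
    rw [coeff_coeffDerivation, PowerSeries.coeff_mk, PowerSeries.coeff_mk, hC]
    have hfac : ((n + 1).factorial : ℝ)⁻¹ * n.choose x.1 * (n + 1) =
        (x.1.factorial : ℝ)⁻¹ * (x.2.factorial : ℝ)⁻¹ := by
      subst hx
      have := Nat.add_choose_mul_factorial_mul_factorial x.1 x.2
      have h' : (((x.1 + x.2).choose x.1 * x.1.factorial * x.2.factorial : ℕ) : ℝ) =
        (x.1 + x.2).factorial := by rw [Nat.choose_symm_add, this]
      rw [Nat.factorial_succ]
      have h1 : (x.1.factorial : ℝ) ≠ 0 := by positivity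
      have h2 : (x.2.factorial : ℝ) ≠ 0 := by positivity
      have h3 : ((x.1 + x.2).factorial : ℝ) ≠ 0 := by positivity
      push_cast at h' ⊢
      field_simp
      linear_combination h'
    have hfac' := congrArg (PowerSeries.C (R := ℝ)) hfac
    simp only [map_mul, map_add, map_natCast, map_one] at hfac' ⊢
    linear_combination R x.1 * eulerDerivation (R x.2) * hfac'
  have hcomm : Function.Commute D₁ (coeffDerivation eulerDerivation) := by
    intro v
    ext1 n
    rw [hD₁, coeff_coeffDerivation, coeff_coeffDerivation, hD₁, Derivation.leibniz]
    simp [mul_comm]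
  have : CharZero (PowerSeries (PowerSeries ℝ)) :=
    charZero_of_injective_ringHom (f := PowerSeries.C.comp (PowerSeries.C (R := ℝ)))
      (PowerSeries.C_injective.comp PowerSeries.C_injective)
  -- Setting z = 0 leaves (n + 1) R n = (t d/dt)ⁿ (1 - t)^(-n-1).
  have key := congrArg PowerSeries.constantCoeff
    (iterate_derivation_of_burgers D₁ (coeffDerivation eulerDerivation) hcomm hu n)
  rw [map_mul, hcoeff, hconst, map_pow] at key
  have hu0 : PowerSeries.constantCoeff u = geomSeries := by
    simpa [R, h0] using hcoeff 0
  rw [hu0, iterate_eulerDerivation_geomSeries_pow] at key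
  refine coe_mul_geomSeries_pow_inj (k := 2 * n + 1) ?_
  rw [show 2 * n + 1 = n + 1 + n by omega, ← key]
  simp only [R, Polynomial.coe_mul]
  rw [Polynomial.coe_C]
  simp only [map_add, map_natCast, map_one]
  rw [mul_assoc, show 2 * n + 1 = n + 1 + n by omega]

/-! ### Quasi-Stirling words as lists, over arbitrary finite alphabets. -/

/-- The number of descents of a word, the last position always counting as one. -/
def desList : List ℕ → ℕ
  | [] => 0
  | [_] => 1
  | a :: b :: l => (if b < a then 1 else 0) + desList (b :: l)

/-- No two letters occur in the pattern `a … b … a … b`. -/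
def Noncrossing (w : List ℕ) : Prop := ∀ a b, ¬ [a, b, a, b].Sublist w

open Classical in
/-- The quasi-Stirling words in which each letter of `S` occurs twice. -/
noncomputable def qsWords (S : Finset ℕ) : Finset (List ℕ) :=
  (S.val + S.val).lists.toFinset.filter Noncrossing

/-- The descent polynomial of `qsWords S`. -/
noncomputable def qsPoly (S : Finset ℕ) : ℝ[X] := ∑ w ∈ qsWords S, X ^ desList w

lemma mem_qsWords {S : Finset ℕ} {w : List ℕ} :
    w ∈ qsWords S ↔ (∀ a, w.count a = if a ∈ S then 2 else 0) ∧ Noncrossing w := by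
  classical
  rw [qsWords, Finset.mem_filter, Multiset.mem_toFinset, Multiset.mem_lists_iff]
  change S.val + S.val = (w : Multiset ℕ) ∧ _ ↔ _
  rw [eq_comm, Multiset.ext]
  refine and_congr_left fun _ => forall_congr' fun a => ?_
  rw [Multiset.count_add, Multiset.coe_count,
    Multiset.count_eq_of_nodup S.nodup]
  simp only [Finset.mem_val]
  split_ifs <;> rfl

lemma mem_iff_of_mem_qsWords {S : Finset ℕ} {w : List ℕ} (h : w ∈ qsWords S) {a : ℕ} :
    a ∈ w ↔ a ∈ S := by
  rw [← List.count_pos_iff, (mem_qsWords.1 h).1 a]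
  split_ifs with h <;> simp [h]

lemma length_of_mem_qsWords {S : Finset ℕ} {w : List ℕ} (h : w ∈ qsWords S) :
    w.length = 2 * S.card := by
  classical
  rw [qsWords, Finset.mem_filter, Multiset.mem_toFinset, Multiset.mem_lists_iff] at h
  have := congrArg Multiset.card h.1
  simpa [two_mul] using this.symm

lemma sublist_of_sublist_append_right {x : ℕ} {l u v : List ℕ} (hx : x ∉ u)
    (h : (x :: l).Sublist (u ++ v)) : (x :: l).Sublist v := by
  induction u with
  | nil => exact h
  | cons y u ih =>
    rw [List.mem_cons, not_or] at hx
    rw [List.cons_append] at h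
    cases h with
    | cons _ h => exact ih hx.2 h
    | cons_cons _ h => exact absurd rfl hx.1

lemma sublist_of_sublist_append_left {x : ℕ} {l u v : List ℕ} (hx : x ∉ v)
    (h : (l ++ [x]).Sublist (u ++ v)) : (l ++ [x]).Sublist u := by
  rw [← List.reverse_sublist] at h ⊢
  simp only [List.reverse_append, List.reverse_cons, List.reverse_nil, List.nil_append,
    List.singleton_append] at h ⊢
  exact sublist_of_sublist_append_right (by simpa using hx) h

lemma Noncrossing.sublist {u v : List ℕ} (h : Noncrossing v) (huv : u.Sublist v) :
    Noncrossing u := fun a b hab => h a b (hab.trans huv)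

/-- A crossing of a letter of B with an outside letter would put the outside letter between two
letters of the contiguous block B. A crossing of two outside letters survives deleting B. -/
lemma Noncrossing.append_block {u B v : List ℕ} (hB : Noncrossing B) (huv : Noncrossing (u ++ v))
    (hu : ∀ x ∈ B, x ∉ u) (hv : ∀ x ∈ B, x ∉ v) : Noncrossing (u ++ (B ++ v)) := by
  intro a b h
  by_cases ha : a ∈ B <;> by_cases hb : b ∈ B
  · exact hB a b (sublist_of_sublist_append_left (l := [a, b, a]) (hv b hb)
      (sublist_of_sublist_append_right (hu a ha) h))
  · have h1 : [a, b, a].Sublist (u ++ (B ++ v)) :=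
      (List.sublist_append_left [a, b, a] [b]).trans h
    have h2 := sublist_of_sublist_append_left (l := [a, b]) (hv a ha)
      (sublist_of_sublist_append_right (hu a ha) h1)
    exact hb (h2.subset (by simp))
  · have h1 : [b, a, b].Sublist (u ++ (B ++ v)) := (List.sublist_cons_self a [b, a, b]).trans h
    have h2 := sublist_of_sublist_append_left (l := [b, a]) (hv b hb)
      (sublist_of_sublist_append_right (hu b hb) h1)
    exact ha (h2.subset (by simp))
  · have h1 := h.filter (fun x => decide (x ∉ B))
    have h2 : (B.filter fun x => decide (x ∉ B)) = [] := by
      rw [List.filter_eq_nil_iff]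
      intro x hx
      simpa using hx
    rw [List.filter_append, List.filter_append, h2, List.nil_append, ← List.filter_append] at h1
    refine huv a b (List.Sublist.trans ?_ (h1.trans List.filter_sublist))
    simp [ha, hb]

lemma Noncrossing.cons_append_singleton {B : List ℕ} (hB : Noncrossing B) {M : ℕ} (hM : M ∉ B) :
    Noncrossing (M :: (B ++ [M])) := by
  intro a b h
  -- `Noncrossing` with a = b forbids four copies of one letter, so this case is separate.
  by_cases hab : a = b
  · subst hab
    have := h.count_le a
    by_cases ha : M = a
    · subst ha
      simp [List.count_eq_zero_of_not_mem hM] at this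
    · exact hB a a (sublist_of_sublist_append_left (v := [M]) (l := [a, a, a]) (by simp; tauto)
        (sublist_of_sublist_append_right (u := [M]) (by simp; tauto) h))
  by_cases ha : a = M
  · have hb : b ≠ M := fun hb => hab (ha.trans hb.symm)
    have h1 : [b, a, b].Sublist (M :: (B ++ [M])) := (List.sublist_cons_self a [b, a, b]).trans h
    have h2 := sublist_of_sublist_append_left (v := [M]) (l := [b, a]) (by simpa using hb)
      (sublist_of_sublist_append_right (u := [M]) (by simpa using hb) h1)
    exact hM (h2.subset (by simp [ha]))
  · by_cases hb : b = M
    · have h1 : [a, b, a].Sublist (M :: (B ++ [M])) :=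
        (List.sublist_append_left [a, b, a] [b]).trans h
      have h2 := sublist_of_sublist_append_left (v := [M]) (l := [a, b]) (by simpa using ha)
        (sublist_of_sublist_append_right (u := [M]) (by simpa using ha) h1)
      exact hM (h2.subset (by simp [hb]))
    · exact hB a b (sublist_of_sublist_append_left (v := [M]) (l := [a, b, a]) (by simpa using hb)
        (sublist_of_sublist_append_right (u := [M]) (by simpa using ha) h))

lemma append_mem_qsWords_insert {S T : Finset ℕ} {M : ℕ} (hM : M ∉ S) (hT : T ⊆ S)
    {u B v : List ℕ} (hB : B ∈ qsWords T) (huv : u ++ v ∈ qsWords (S \ T)) :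
    u ++ M :: (B ++ M :: v) ∈ qsWords (insert M S) := by
  have hMB : M ∉ B := fun h => hM (hT ((mem_iff_of_mem_qsWords hB).1 h))
  have hMuv : M ∉ u ++ v := fun h =>
    hM (Finset.mem_sdiff.1 ((mem_iff_of_mem_qsWords huv).1 h)).1
  have hdisj : ∀ x ∈ B, x ∉ u ++ v := fun x hx h =>
    (Finset.mem_sdiff.1 ((mem_iff_of_mem_qsWords huv).1 h)).2 ((mem_iff_of_mem_qsWords hB).1 hx)
  have hblock : ∀ x ∈ M :: (B ++ [M]), x ∉ u ++ v := by
    intro x hx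
    rw [List.mem_cons, List.mem_append, List.mem_singleton] at hx
    rcases hx with rfl | hx | rfl
    · exact hMuv
    · exact hdisj x hx
    · exact hMuv
  rw [mem_qsWords]
  constructor
  · intro a
    have h1 := (mem_qsWords.1 hB).1 a
    have h2 := (mem_qsWords.1 huv).1 a
    rw [List.count_append] at h2
    simp only [List.count_append, List.count_cons, Finset.mem_insert, Finset.mem_sdiff,
      beq_iff_eq] at h1 h2 ⊢
    by_cases haM : a = M
    · subst haM
      have : a ∉ T := fun h => hM (hT h)
      simp [hM, this] at h1 h2 ⊢
      omega
    · have haM' : M ≠ a := Ne.symm haM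
      by_cases haT : a ∈ T
      · have := hT haT
        simp only [haT, this, haM, haM', not_true_eq_false, and_false, or_true, if_true, if_false]
          at h1 h2 ⊢
        omega
      · simp only [haT, haM, haM', not_false_eq_true, and_true, false_or, if_false] at h1 h2 ⊢
        omega
  · have := ((mem_qsWords.1 hB).2.cons_append_singleton hMB).append_block (mem_qsWords.1 huv).2
      (fun x hx h => hblock x hx (List.mem_append_left _ h))
      (fun x hx h => hblock x hx (List.mem_append_right _ h))
    simpa using this

/-- Cut at the two copies of M. A letter x inside cannot recur outside, since x M x M or M x M x
would appear; so B contains both copies of each of its letters. -/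
lemma exists_of_mem_qsWords_insert {S : Finset ℕ} {M : ℕ} (hM : M ∉ S) {w : List ℕ}
    (hw : w ∈ qsWords (insert M S)) : ∃ T ⊆ S, ∃ B ∈ qsWords T, ∃ u v,
      u ++ v ∈ qsWords (S \ T) ∧ w = u ++ M :: (B ++ M :: v) := by
  obtain ⟨hc, hn⟩ := mem_qsWords.1 hw
  obtain ⟨u, w', rfl, hu⟩ := List.eq_append_cons_of_mem
    ((mem_iff_of_mem_qsWords hw).2 (Finset.mem_insert_self M S))
  have hcM := hc M
  simp only [List.count_append, List.count_cons_self, Finset.mem_insert_self, if_true,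
    List.count_eq_zero_of_not_mem hu] at hcM
  obtain ⟨B, v, rfl, hB⟩ := List.eq_append_cons_of_mem
    (List.count_pos_iff.1 (show 0 < w'.count M by omega))
  simp only [List.count_append, List.count_cons_self, List.count_eq_zero_of_not_mem hB] at hcM
  have hv : M ∉ v := List.count_eq_zero.1 (by omega)
  have hBu : ∀ x ∈ B, x ∉ u := by
    intro x hx hxu
    refine hn x M ?_
    have h1 : [x].Sublist u := List.singleton_sublist.2 hxu
    have h2 : [x].Sublist B := List.singleton_sublist.2 hx
    exact h1.append ((h2.append ((List.nil_sublist v).cons_cons M)).cons_cons M)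
  have hBv : ∀ x ∈ B, x ∉ v := by
    intro x hx hxv
    refine hn M x ?_
    have h1 : [x].Sublist v := List.singleton_sublist.2 hxv
    have h2 : [x].Sublist B := List.singleton_sublist.2 hx
    exact (List.nil_sublist u).append ((h2.append (h1.cons_cons M)).cons_cons M)
  have hMx : ∀ x ∈ B, x ≠ M := fun x hx h => hB (h ▸ hx)
  have hcount : ∀ a, a ≠ M → u.count a + (B.count a + v.count a) = if a ∈ S then 2 else 0 := by
    intro a ha
    have := hc a
    simpa [List.count_append, List.count_cons, ha, Ne.symm ha] using this
  have hBS : ∀ x ∈ B, x ∈ S := by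
    intro x hx
    by_contra hxS
    have := hcount x (hMx x hx)
    have h2 := List.count_pos_iff.2 hx
    rw [if_neg hxS] at this
    omega
  refine ⟨B.toFinset, fun x hx => hBS x (List.mem_toFinset.1 hx), B, mem_qsWords.2 ⟨fun a => ?_,
    hn.sublist ?_⟩, u, v, mem_qsWords.2 ⟨fun a => ?_, hn.sublist ?_⟩, rfl⟩
  · by_cases ha : a ∈ B
    · have := hcount a (hMx a ha)
      rw [List.count_eq_zero_of_not_mem (hBu a ha), List.count_eq_zero_of_not_mem (hBv a ha),
        if_pos (hBS a ha)] at this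
      rw [if_pos (List.mem_toFinset.2 ha)]
      omega
    · rw [if_neg (mt List.mem_toFinset.1 ha), List.count_eq_zero_of_not_mem ha]
  · exact ((List.sublist_append_left B (M :: v)).trans (List.sublist_cons_self _ _)).trans
      (List.sublist_append_right _ _)
  · rw [List.count_append]
    by_cases haM : a = M
    · subst haM
      simp [hM, List.count_eq_zero_of_not_mem hu, List.count_eq_zero_of_not_mem hv]
    · have := hcount a haM
      by_cases ha : a ∈ B
      · rw [List.count_eq_zero_of_not_mem (hBu a ha), List.count_eq_zero_of_not_mem (hBv a ha)]
        simp [ha]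
      · rw [List.count_eq_zero_of_not_mem ha, zero_add] at this
        simp [ha, this]
  · exact (List.Sublist.refl u).append (((List.sublist_cons_self M v).trans
      (List.sublist_append_right B (M :: v))).trans (List.sublist_cons_self _ _))

/-! ### Descents under insertion of the largest letter. -/

lemma desList_append_cons_of_lt {B : List ℕ} {M : ℕ} (hB : ∀ x ∈ B, x < M) (hne : B ≠ [])
    (v : List ℕ) : desList (B ++ M :: v) + 1 = desList B + desList (M :: v) := by
  induction B with
  | nil => exact absurd rfl hne
  | cons x B ih =>
    rcases B with _ | ⟨y, B⟩
    · have := hB x (by simp)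
      simp [desList, not_lt.2 this.le]
      omega
    · have := ih (fun z hz => hB z (List.mem_cons_of_mem _ hz)) (by simp)
      simp only [List.cons_append, desList] at this ⊢
      omega

/-- A nonempty B loses its conventional final descent, as it is followed by M, but gains the descent
from M to its first letter. -/
lemma desList_insert_block (u : List ℕ) {B : List ℕ} {M : ℕ} (hB : ∀ x ∈ B, x < M) (v : List ℕ) :
    desList (u ++ M :: (B ++ M :: v)) = desList B + desList (u ++ M :: M :: v) := by
  induction u with
  | nil =>
    rcases B with _ | ⟨y, B⟩
    · simp [desList]
    · have := desList_append_cons_of_lt hB (by simp) v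
      have hy := hB y (by simp)
      simp only [List.cons_append, List.nil_append, desList, hy, if_true, lt_irrefl,
        if_false] at this ⊢
      omega
  | cons x u ih =>
    rcases u with _ | ⟨y, u⟩
    · simp only [List.cons_append, List.nil_append, desList] at ih ⊢
      omega
    · simp only [List.cons_append, desList] at ih ⊢
      omega

lemma desList_cons_of_lt {M : ℕ} {v : List ℕ} (hv : ∀ x ∈ v, x < M) :
    desList (M :: v) = 1 + desList v := by
  rcases v with _ | ⟨y, v⟩
  · rfl
  · simp [desList, hv y (by simp)]

/-- Inserting M M right after a descent position, the last one included, keeps the number of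
descents; after any other position it adds one. -/
lemma sum_desList_insert_tail {M : ℕ} {v : List ℕ} (hv : ∀ x ∈ v, x < M) :
    ∑ p ∈ Finset.range v.length, (X : ℝ[X]) ^ desList (v.take (p + 1) ++ M :: M :: v.drop (p + 1)) =
      C (desList v : ℝ) * X ^ desList v + C ((v.length : ℝ) - desList v) * X ^ (desList v + 1) := by
  induction v with
  | nil => simp [desList]
  | cons x v ih =>
    have hx := hv x (by simp)
    have hv' : ∀ y ∈ v, y < M := fun y hy => hv y (List.mem_cons_of_mem _ hy)
    have hfirst : desList (x :: M :: M :: v) = 1 + desList v := by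
      rw [← desList_cons_of_lt hv']
      simp [desList, not_lt.2 hx.le]
    rw [List.length_cons, Finset.sum_range_succ']
    rcases v with _ | ⟨y, v⟩
    · simp [desList, not_lt.2 hx.le]
    · have hstep : ∀ p, desList ((x :: y :: v).take (p + 1 + 1) ++
          M :: M :: (x :: y :: v).drop (p + 1 + 1)) = (if y < x then 1 else 0) +
            desList ((y :: v).take (p + 1) ++ M :: M :: (y :: v).drop (p + 1)) := by
        intro p
        simp [desList]
      simp only [hstep, pow_add _ (ite _ _ _), ← Finset.mul_sum]
      rw [ih hv']
      have h1 : desList ((x :: y :: v).take (0 + 1) ++ M :: M :: (x :: y :: v).drop (0 + 1)) =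
          1 + desList (y :: v) := by simpa using hfirst
      have h2 : desList (x :: y :: v) = (if y < x then 1 else 0) + desList (y :: v) := rfl
      rw [h1, h2]
      generalize desList (y :: v) = e
      split_ifs
      · simp only [Nat.cast_add, Nat.cast_one, C_add, C_sub, C_1, pow_succ, pow_add]
        ring
      · simp only [Nat.cast_add, Nat.cast_one, Nat.cast_zero, C_add, C_sub, C_1, C_0, pow_succ,
          pow_add]
        ring

lemma sum_desList_insert {M : ℕ} {v : List ℕ} (hv : ∀ x ∈ v, x < M) :
    ∑ p ∈ Finset.range (v.length + 1), (X : ℝ[X]) ^ desList (v.take p ++ M :: M :: v.drop p) =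
      X * ((1 - X) * derivative (X ^ desList v) + C ((v.length + 1 : ℕ) : ℝ) * X ^ desList v) := by
  have h0 : desList (M :: M :: v) = 1 + desList v := by
    rw [← desList_cons_of_lt hv]
    simp [desList]
  rw [Finset.sum_range_succ', sum_desList_insert_tail hv]
  simp only [List.take_zero, List.drop_zero, List.nil_append, h0]
  rw [mul_add, mul_left_comm, X_mul_derivative_X_pow]
  simp only [Nat.cast_add, Nat.cast_one, C_add, C_sub, C_1, pow_succ, pow_add]
  ring

lemma append_cons_append_cons_inj {M : ℕ} {u B v u' B' v' : List ℕ} (hu : M ∉ u) (hu' : M ∉ u')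
    (hB : M ∉ B) (hB' : M ∉ B') (h : u ++ M :: (B ++ M :: v) = u' ++ M :: (B' ++ M :: v')) :
    u = u' ∧ B = B' ∧ v = v' := by
  have key : ∀ {s t s' t' : List ℕ}, M ∉ s → M ∉ s' → s ++ M :: t = s' ++ M :: t' →
      s = s' ∧ t = t' := by
    intro s t s'
    induction s generalizing s' with
    | nil =>
      rcases s' with _ | ⟨y, s'⟩
      · simp
      · intro t' _ h2 h3
        simp at h2 h3
        exact absurd h3.1 h2.1
    | cons x s ih =>
      intro t' h1 h2 h3
      rcases s' with _ | ⟨y, s'⟩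
      · simp at h1 h3
        exact absurd h3.1.symm h1.1
      · simp only [List.cons_append, List.cons.injEq, List.mem_cons, not_or] at h1 h2 h3
        obtain ⟨h4, h5⟩ := ih h1.2 h2.2 h3.2
        exact ⟨by rw [h3.1, h4], h5⟩
  obtain ⟨h1, h2⟩ := key hu hu' h
  obtain ⟨h3, h4⟩ := key hB hB' h2
  exact ⟨h1, h3, h4⟩

/-! ### The recurrence for the descent polynomials. -/

lemma qsPoly_insert {S : Finset ℕ} {M : ℕ} (hM : ∀ x ∈ S, x < M) :
    qsPoly (insert M S) = ∑ T ∈ S.powerset, qsPoly T * (X * ((1 - X) * derivative (qsPoly (S \ T)) +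
      C ((2 * (S \ T).card + 1 : ℕ) : ℝ) * qsPoly (S \ T))) := by
  have hMS : M ∉ S := fun h => lt_irrefl _ (hM M h)
  have hinner : ∀ T ∈ S.powerset, qsPoly T * (X * ((1 - X) * derivative (qsPoly (S \ T)) +
      C ((2 * (S \ T).card + 1 : ℕ) : ℝ) * qsPoly (S \ T))) =
      ∑ y ∈ qsWords T ×ˢ qsWords (S \ T), ∑ p ∈ Finset.range (y.2.length + 1),
        (X : ℝ[X]) ^ desList (y.2.take p ++ M :: (y.1 ++ M :: y.2.drop p)) := by
    intro T hT
    rw [Finset.mem_powerset] at hT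
    rw [Finset.sum_product, qsPoly, Finset.sum_mul]
    refine Finset.sum_congr rfl fun B hB => ?_
    rw [qsPoly, derivative_sum, Finset.mul_sum, Finset.mul_sum, ← Finset.sum_add_distrib,
      Finset.mul_sum, Finset.mul_sum]
    refine Finset.sum_congr rfl fun w hw => ?_
    rw [← length_of_mem_qsWords hw, ← sum_desList_insert, Finset.mul_sum]
    · refine Finset.sum_congr rfl fun p _ => ?_
      rw [desList_insert_block, pow_add]
      exact fun x hx => hM x (hT ((mem_iff_of_mem_qsWords hB).1 hx))
    · exact fun x hx => hM x (Finset.mem_sdiff.1 ((mem_iff_of_mem_qsWords hw).1 hx)).1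
  rw [Finset.sum_congr rfl hinner, qsPoly]
  simp only [Finset.sum_sigma']
  symm
  -- A word u M B M v corresponds to the alphabet T of B, the word B, the word u v, and the cut p =
  -- |u|, one of 2 |S \ T| + 1 gaps.
  refine Finset.sum_nbij
    (fun y => y.2.1.2.take y.2.2 ++ M :: (y.2.1.1 ++ M :: y.2.1.2.drop y.2.2)) ?_ ?_ ?_ ?_
  · rintro ⟨T, ⟨⟨B, w⟩, p⟩⟩ hy
    simp only [Finset.mem_sigma, Finset.mem_powerset, Finset.mem_product] at hy
    exact append_mem_qsWords_insert hMS hy.1 hy.2.1.1 (by rw [List.take_append_drop]; exact hy.2.1.2)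
  · rintro ⟨T, ⟨⟨B, w⟩, p⟩⟩ hy ⟨T', ⟨⟨B', w'⟩, p'⟩⟩ hy' h
    simp only [Finset.coe_sigma, Set.mem_sigma_iff, Finset.mem_coe, Finset.mem_powerset,
      Finset.mem_product, Finset.mem_range] at hy hy' h
    obtain ⟨hT, ⟨hB, hw⟩, hp⟩ := hy
    obtain ⟨hT', ⟨hB', hw'⟩, hp'⟩ := hy'
    have hMB : ∀ {T B}, T ⊆ S → B ∈ qsWords T → M ∉ B := fun hT hB h =>
      hMS (hT ((mem_iff_of_mem_qsWords hB).1 h))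
    obtain ⟨h1, rfl, h2⟩ := append_cons_append_cons_inj
      (fun h => hMB Finset.sdiff_subset hw (List.mem_of_mem_take h))
      (fun h => hMB Finset.sdiff_subset hw' (List.mem_of_mem_take h)) (hMB hT hB) (hMB hT' hB') h
    have hww : w = w' := by rw [← List.take_append_drop p w, h1, h2, List.take_append_drop]
    subst hww
    have hpp : p = p' := by
      have := congrArg List.length h1
      rw [List.length_take, List.length_take] at this
      omega
    have hTT : T = T' := by
      ext a
      rw [← mem_iff_of_mem_qsWords hB, mem_iff_of_mem_qsWords hB']
    subst hpp hTT
    rfl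
  · intro w hw
    obtain ⟨T, hT, B, hB, u, v, huv, rfl⟩ := exists_of_mem_qsWords_insert hMS hw
    refine ⟨⟨T, ⟨(B, u ++ v), u.length⟩⟩, ?_, ?_⟩
    · simp [hT, hB, huv]
    · simp
  · intro _ _
    rfl

lemma qsPoly_insert_eq_sum_range {S : Finset ℕ} {M : ℕ} (hM : ∀ x ∈ S, x < M) (q : ℕ → ℝ[X])
    (hq : ∀ T ⊆ S, qsPoly T = q T.card) : qsPoly (insert M S) =
      ∑ k ∈ Finset.range (S.card + 1), C (S.card.choose k : ℝ) * (q k *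
        (X * ((1 - X) * derivative (q (S.card - k)) +
          C ((2 * (S.card - k) + 1 : ℕ) : ℝ) * q (S.card - k)))) := by
  have h := Finset.sum_powerset_apply_card (x := S) fun k => q k *
    (X * ((1 - X) * derivative (q (S.card - k)) +
      C ((2 * (S.card - k) + 1 : ℕ) : ℝ) * q (S.card - k)))
  simp only [nsmul_eq_mul, ← map_natCast (C : ℝ →+* ℝ[X])] at h
  rw [qsPoly_insert hM, ← h]
  refine Finset.sum_congr rfl fun T hT => ?_
  rw [Finset.mem_powerset] at hT
  rw [hq T hT, hq _ Finset.sdiff_subset, Finset.card_sdiff_of_subset hT]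

/-- Removing the maximum gives a recurrence that sees only cardinalities, so no relabelling
bijection is needed. -/
lemma qsPoly_eq_range_card (n : ℕ) :
    ∀ S : Finset ℕ, S.card = n → qsPoly S = qsPoly (Finset.range n) := by
  induction n using Nat.strong_induction_on with
  | _ n ih =>
    intro S hS
    rcases n with _ | n
    · rw [Finset.card_eq_zero.1 hS, Finset.range_zero]
    · have hne : S.Nonempty := Finset.card_pos.1 (by omega)
      have hcard : (S.erase (S.max' hne)).card = n := by
        rw [Finset.card_erase_of_mem (S.max'_mem hne), hS, Nat.add_sub_cancel]
      have h1 := qsPoly_insert_eq_sum_range (S := S.erase (S.max' hne)) (M := S.max' hne)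
        (fun x hx => S.lt_max'_of_mem_erase_max' hne hx) (fun k => qsPoly (Finset.range k))
        (fun T hT => ih _ (by have := Finset.card_le_card hT; omega) T rfl)
      have h2 := qsPoly_insert_eq_sum_range (S := Finset.range n) (M := n)
        (fun x hx => Finset.mem_range.1 hx) (fun k => qsPoly (Finset.range k))
        (fun T hT => ih _ (by have := Finset.card_le_card hT; simp at this; omega) T rfl)
      rw [Finset.insert_erase (S.max'_mem hne), hcard] at h1
      rw [Finset.card_range, ← Finset.range_add_one] at h2
      rw [h1, h2]

lemma qsPoly_range_succ (n : ℕ) : qsPoly (Finset.range (n + 1)) =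
    ∑ x ∈ Finset.HasAntidiagonal.antidiagonal n, C (n.choose x.1 : ℝ) * (qsPoly (Finset.range x.1) *
      (X * ((1 - X) * derivative (qsPoly (Finset.range x.2)) +
        C ((2 * x.2 + 1 : ℕ) : ℝ) * qsPoly (Finset.range x.2)))) := by
  have h := qsPoly_insert_eq_sum_range (S := Finset.range n) (M := n)
    (fun x hx => Finset.mem_range.1 hx) (fun k => qsPoly (Finset.range k))
    (fun T _ => qsPoly_eq_range_card _ T rfl)
  rw [Finset.card_range, ← Finset.range_add_one] at h
  rw [h, Finset.Nat.sum_antidiagonal_eq_sum_range_succ_mk]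

lemma qsPoly_empty : qsPoly ∅ = 1 := by
  have h : qsWords ∅ = {[]} := by
    ext w
    rw [Finset.mem_singleton]
    constructor
    · intro h
      exact List.eq_nil_of_length_eq_zero (by simpa using length_of_mem_qsWords h)
    · rintro rfl
      exact mem_qsWords.2 ⟨by simp, fun a b h => by simp at h⟩
  simp [qsPoly, h, desList]

/-! ### From words as functions to words as lists. -/

lemma desCount_eq_desList {s n : ℕ} (π : Fin s → Fin n) :
    desCount π = desList (List.ofFn fun i => (π i : ℕ)) := by
  induction s with
  | zero => simp [desCount, desList]
  | succ s ih =>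
    have h := ih fun i => π i.succ
    rw [desCount] at h ⊢
    rw [Fin.card_filter_univ_succ', List.ofFn_succ]
    have htail : (Finset.univ.filter fun i : Fin s => ((i.succ : Fin (s + 1)) : ℕ) + 1 = s + 1 ∨
        ∃ h : ((i.succ : Fin (s + 1)) : ℕ) + 1 < s + 1,
          π ⟨((i.succ : Fin (s + 1)) : ℕ) + 1, h⟩ < π i.succ) =
        Finset.univ.filter fun i : Fin s => (i : ℕ) + 1 = s ∨
          ∃ h : (i : ℕ) + 1 < s, π (Fin.succ ⟨(i : ℕ) + 1, h⟩) < π i.succ := by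
      refine Finset.filter_congr fun i _ => ?_
      simp [Fin.succ]
    rw [htail, h]
    rcases s with _ | s
    · rw [if_pos (Or.inl (by simp)), List.ofFn_zero]
      rfl
    · rw [List.ofFn_succ, desList]
      congr 1
      refine if_congr ⟨?_, fun h => Or.inr ⟨by simp, h⟩⟩ rfl rfl
      rintro (h | ⟨_, h⟩)
      · simp at h
      · exact h

lemma count_ofFn {m : ℕ} (f : Fin m → ℕ) (a : ℕ) :
    (List.ofFn f).count a = (Finset.univ.filter fun i => f i = a).card := by
  induction m with
  | zero => simp
  | succ m ih =>
    rw [Fin.card_filter_univ_succ', List.ofFn_succ, List.count_cons, ih, add_comm]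
    simp

/-- Sublists of the word are the images of increasing lists of positions. -/
lemma noncrossing_ofFn_iff {m : ℕ} (f : Fin m → ℕ) : Noncrossing (List.ofFn f) ↔
    ¬ ∃ i j k l : Fin m, i < j ∧ j < k ∧ k < l ∧ f i = f k ∧ f j = f l := by
  rw [Noncrossing, ← not_exists.trans (forall_congr' fun _ => not_exists), not_iff_not,
    List.ofFn_eq_map]
  constructor
  · rintro ⟨a, b, h⟩
    obtain ⟨l', hl', heq⟩ := List.sublist_map_iff.1 h
    have hp := (List.pairwise_lt_finRange m).sublist hl'
    rcases l' with _ | ⟨i, _ | ⟨j, _ | ⟨k, _ | ⟨l, _ | ⟨x, t⟩⟩⟩⟩⟩ <;>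
      simp only [List.map_cons, List.map_nil, List.cons.injEq, and_true, and_false, reduceCtorEq]
        at heq
    · simp only [List.pairwise_cons, List.mem_cons] at hp
      exact ⟨i, j, k, l, hp.1 j (by simp), hp.2.1 k (by simp), hp.2.2.1 l (by simp),
        heq.1.symm.trans heq.2.2.1, heq.2.1.symm.trans heq.2.2.2⟩
  · rintro ⟨i, j, k, l, hij, hjk, hkl, hik, hjl⟩
    refine ⟨f i, f j, List.sublist_map_iff.2 ⟨[i, j, k, l], ?_, by simp [hik, hjl]⟩⟩
    have hp : [i, j, k, l].Pairwise (· < ·) := by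
      simp [hij, hjk, hkl, hij.trans hjk, hjk.trans hkl, (hij.trans hjk).trans hkl]
    refine List.sublist_of_subperm_of_pairwise ?_ hp (List.pairwise_lt_finRange m)
    exact List.subperm_of_subset (hp.imp fun h => h.ne) fun x _ => List.mem_finRange x

lemma isQuasiStirling_iff {n : ℕ} (π : Fin (2 * n) → Fin n) :
    IsQuasiStirling π ↔ (List.ofFn fun i => (π i : ℕ)) ∈ qsWords (Finset.range n) := by
  rw [mem_qsWords, IsQuasiStirling, noncrossing_ofFn_iff]
  refine and_congr ⟨fun h a => ?_, fun h a => ?_⟩ (by simp only [Fin.ext_iff])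
  · rw [count_ofFn]
    split_ifs with ha
    · have := h ⟨a, Finset.mem_range.1 ha⟩
      simpa only [Fin.ext_iff] using this
    · refine Finset.card_eq_zero.2 (Finset.filter_eq_empty_iff.2 fun i _ hi => ha ?_)
      rw [← hi]
      exact Finset.mem_range.2 (π i).isLt
  · have := h a
    rw [count_ofFn, if_pos (Finset.mem_range.2 a.isLt)] at this
    simpa only [Fin.ext_iff] using this

lemma quasiStirlingPoly_eq (n : ℕ) : quasiStirlingPoly n = qsPoly (Finset.range n) := by
  rw [quasiStirlingPoly, qsPoly]
  refine Finset.sum_nbij (fun π => List.ofFn fun i => (π i : ℕ)) ?_ ?_ ?_ ?_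
  · intro π hπ
    exact (isQuasiStirling_iff π).1 (Finset.mem_filter.1 hπ).2
  · intro π _ σ _ h
    have := List.ofFn_injective h
    exact funext fun i => Fin.ext (congrFun this i)
  · intro w hw
    have hlen : w.length = 2 * n := by simpa using length_of_mem_qsWords hw
    have hlt : ∀ i : Fin (2 * n), w[(i : ℕ)] < n := fun i =>
      Finset.mem_range.1 ((mem_iff_of_mem_qsWords hw).1 (List.getElem_mem _))
    have heq : (List.ofFn fun i : Fin (2 * n) => w[(i : ℕ)]) = w :=
      List.ext_getElem (by simp [hlen]) fun i _ _ => by simp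
    refine ⟨fun i => ⟨w[(i : ℕ)], hlt i⟩, ?_, heq⟩
    rw [Finset.mem_coe, Finset.mem_filter, isQuasiStirling_iff]
    exact ⟨Finset.mem_univ _, heq.symm ▸ hw⟩
  · intro π _
    rw [desCount_eq_desList]

lemma hasRealDistinctNonposRoots_quasiStirlingPoly {n : ℕ} (hn : 1 ≤ n) :
    HasRealDistinctNonposRoots (quasiStirlingPoly n) := by
  have h := eq_geomNumerator_of_recurrence (fun k => qsPoly (Finset.range k)) qsPoly_empty
    qsPoly_range_succ n
  obtain ⟨m, rfl⟩ : ∃ m, n = m + 1 := ⟨n - 1, by omega⟩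
  obtain ⟨s, hs, heq⟩ := geomNumerator_succ_eq (m + 1 + 1) m (by omega)
  have hpos : (0 : ℝ) < ((m + 1 : ℕ) : ℝ) + 1 := by positivity
  have hq : quasiStirlingPoly (m + 1) = X * (C (((m + 1 : ℕ) : ℝ) + 1)⁻¹ * s) := by
    rw [mul_left_comm, ← heq, ← h, ← mul_assoc, ← C_mul, inv_mul_cancel₀ hpos.ne', C_1, one_mul,
      quasiStirlingPoly_eq]
  rw [hq]
  exact (hs.const_mul (inv_pos.2 hpos)).X_mul

theorem theorem3p2 (n r : ℕ) (hr : 1 ≤ r) (hrn : r ≤ n) :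
    HasRealDistinctNonposRoots (rEulerianPoly n r) ∧
      HasRealDistinctNonposRoots (injExcPoly n r) ∧
      HasRealDistinctNonposRoots (quasiStirlingPoly n) :=
  ⟨(hasSimpleNegRoots_rEulerianPoly hr hrn).hasRealDistinctNonposRoots,
    (hasSimpleNegRoots_injExcPoly hr hrn).hasRealDistinctNonposRoots,
    hasRealDistinctNonposRoots_quasiStirlingPoly (hr.trans hrn)⟩
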